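/- Fix a delay parameter $K\ge 1$. In the \emph{Mirror problem} with delay $K$ one receives bits $\Delta_1,\dots,\Delta_T\in\{0,1\}$ one at a time and answers each with $y_t\in\{\top,\bot\}$, subject to: $y_t=\bot$ whenever $\Delta_t=0$, and $y_t=\top$ only if $\sum_{i<t}\Delta_i\ge K$. A \emph{mistake} occurs at time $t$ if $\Delta_t=1$, $\sum_{i\le t}\Delta_i>K$ and $y_t=\bot$. For $\varepsilon'>0$ and $\delta'\in(0,1/10)$ let $L=L(\varepsilon',\delta')$ be the least $j\in\mathbb{N}$ with $\delta' e^{(j-1)\varepsilon'}>1/2$, let $r\le\varepsilon'$ be the solution of $\delta' e^{(L-1)r}=1/2$, and define $\pi(0)=0$, $\pi(i)=\delta' e^{(i-1)r}$ for $1\le i\le L$, $\pi(i)=1-\delta' e^{(2L-i)r}$ for $L+1\le i\le 2L$, and $\pi(i)=1$ for $i>2L$. Algorithm JDP-Mirror keeps a counter $C$, initially $0$. On input $\Delta_t=0$ it outputs $\bot$. On input $\Delta_t=1$ it increases $C$ by $1$ and, with fresh randomness, outputs $\top$ with probability $\pi(\max\{0,C-K\})$ and $\bot$ otherwise. For distributions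 $P,Q$ write $P\approx_{\varepsilon,\delta}Q$ if $P(S)\le e^{\varepsilon}Q(S)+\delta$ and $Q(S)\le e^{\varepsilon}P(S)+\delta$ for every event $S$. A randomized algorithm $M:X^T\to Y^T$ is \emph{$(\varepsilon,\delta)$-jointly differentially private} (JDP) if for every $i$ and all $S,S'\in X^T$ that differ only in the $i$th point, $M(S)_{-i}\approx_{\varepsilon,\delta}M(S')_{-i}$, where $_{-i}$ means that the $i$th output is removed. \textbf{Theorem.} There are absolute constants $c_1,c_2,B>0$ with $c_2\le 1$ such that the following holds for all $\varepsilon\in(0,2]$ and $\delta\in(0,1/10)$, with $\varepsilon'=c_1\varepsilon^2/\log(1/\delta)$, $\delta'=c_2\delta$, and $\pi$, $L$ as above for $(\varepsilon',\delta')$. \begin{itemize} \item The numbers $\pi(i)$ are probabilities with $\pi(0)=0$, $\pi(1)=\delta'$, $\pi(2L)=1-\delta'$, $\pi(i)=1$ for $i>2L$, and $\mathrm{Bern}(\pi(i))\approx_{\varepsilon',0}\mathrm{Bern}(\pi(i+1))$ for $1\le i<2L$. \item $2L\le B\,\varepsilon^{-2}\log^2(1/\delta)$. \item For all $K\ge1$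 and $T\ge 0$, JDP-Mirror with the probabilities $\pi$ and delay $K$, run for $T$ steps, is $(\varepsilon,\delta)$-JDP. \item For all $K\ge1$, $T\ge 0$ and every input $\Delta\in\{0,1\}^T$, every output sequence that JDP-Mirror produces with positive probability satisfies the constraints of the Mirror problem with delay $K$ and has at most $2L$ mistakes. \end{itemize} -/

import Mathlib

namespace JDPMirror

noncomputable section

/-! ### Indistinguishability and joint differential privacy -/

/-- `(ε, δ)`-indistinguishability `P ≈_{ε,δ} Q` of two discrete distributions: for every event `S`,
`P S ≤ e^ε * Q S + δ` and `Q S ≤ e^ε * P S + δ`. -/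
def Indist {Ω : Type*} (ε δ : ℝ) (P Q : PMF Ω) : Prop :=
  ∀ S : Set Ω,
    P.toOuterMeasure S ≤
        ENNReal.ofReal (Real.exp ε) * Q.toOuterMeasure S + ENNReal.ofReal δ ∧
      Q.toOuterMeasure S ≤
        ENNReal.ofReal (Real.exp ε) * P.toOuterMeasure S + ENNReal.ofReal δ

/-- The vector `y` with its `i`-th entry removed. -/
def dropCoord {n : ℕ} {Y : Type*} (i : Fin n) (y : Fin n → Y) : {j : Fin n // j ≠ i} → Y :=
  fun j => y j

/-- `(ε, δ)`-joint differential privacy of a randomized algorithm `M : X^n → Y^n`: if two datasets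
differ only in their `i`-th point, then the outputs without the `i`-th entry are
`(ε, δ)`-indistinguishable. -/
def IsJDP {n : ℕ} {X Y : Type*} (M : (Fin n → X) → PMF (Fin n → Y)) (ε δ : ℝ) : Prop :=
  ∀ (i : Fin n) (S S' : Fin n → X), (∀ j, j ≠ i → S j = S' j) →
    Indist ε δ ((M S).map (dropCoord i)) ((M S').map (dropCoord i))

/-! ### The Mirror problem

Inputs are bits (`true` is `1`, `false` is `0`); in outputs `true` is `⊤` and `false` is `⊥`. -/

/-- The number of inputs equal to `1` strictly before time `t`. -/
def onesBefore {T : ℕ} (Δ : Fin T → Bool) (t : Fin T) : ℕ :=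
  (Finset.univ.filter fun s : Fin T => s < t ∧ Δ s = true).card

/-- The number of inputs equal to `1` up to and including time `t`. -/
def onesUpTo {T : ℕ} (Δ : Fin T → Bool) (t : Fin T) : ℕ :=
  (Finset.univ.filter fun s : Fin T => s ≤ t ∧ Δ s = true).card

/-- The output sequence `y` obeys the constraints of the Mirror problem with delay `K` on the
input `Δ`: on input `0` the answer is `⊥`, and the answer may be `⊤` only after at least `K` prior
inputs equal to `1`. -/
def IsValidMirror {T : ℕ} (K : ℕ) (Δ y : Fin T → Bool) : Prop :=
  ∀ t, (Δ t = false → y t = false) ∧ (y t = true → K ≤ onesBefore Δ t)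

/-- The number of mistakes: times `t` with input `1`, with more than `K` inputs equal to `1` up to
and including `t`, and with answer `⊥`. -/
def mistakes {T : ℕ} (K : ℕ) (Δ y : Fin T → Bool) : ℕ :=
  (Finset.univ.filter fun t : Fin T => Δ t = true ∧ K < onesUpTo Δ t ∧ y t = false).card

/-! ### The probabilities `π` -/

/-- The number `L`: the least `j` with `δ * e^((j - 1) ε) > 1/2`. -/
def halfLength (ε δ : ℝ) : ℕ :=
  sInf {j : ℕ | 1 / 2 < δ * Real.exp (((j : ℝ) - 1) * ε)}

/-- The solution `r ≤ ε` of `δ * e^((L - 1) r) = 1/2`. -/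
def rate (ε δ : ℝ) : ℝ :=
  Real.log (1 / (2 * δ)) / ((halfLength ε δ : ℝ) - 1)

/-- The probabilities `π_{ε,δ}(i)`: zero at `i = 0`, growing geometrically from `δ` to `1/2` for
`1 ≤ i ≤ L`, symmetrically approaching `1 - δ` for `L + 1 ≤ i ≤ 2L`, and `1` for `i > 2L`. -/
def prob (ε δ : ℝ) (i : ℕ) : ℝ :=
  if i = 0 then 0
  else if i ≤ halfLength ε δ then δ * Real.exp (((i : ℝ) - 1) * rate ε δ)
  else if i ≤ 2 * halfLength ε δ then
    1 - δ * Real.exp ((2 * (halfLength ε δ : ℝ) - (i : ℝ)) * rate ε δ)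
  else 1

/-- The Bernoulli distribution with success probability `p`, for `p ∈ [0, 1]` (other reals are
projected to `[0, 1]`); success is `true`. -/
def bern (p : ℝ) : PMF Bool :=
  (ProbabilityTheory.bernoulliMeasure true false (Set.projIcc (0 : ℝ) 1 zero_le_one p)).toPMF

/-- `π` has the properties required of the probabilities with parameters `ε, δ` and length `2L`:
they interpolate from `δ` to `1 - δ` in `2L` steps of which consecutive ones are
`(ε, 0)`-indistinguishable. -/
def Interpolates (π : ℕ → ℝ) (L : ℕ) (ε δ : ℝ) : Prop :=
  (∀ i, 0 ≤ π i ∧ π i ≤ 1) ∧ π 0 = 0 ∧ π 1 = δ ∧ π (2 * L) = 1 - δ ∧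
    (∀ i, 2 * L < i → π i = 1) ∧
    ∀ i, 1 ≤ i → i < 2 * L → Indist ε 0 (bern (π i)) (bern (π (i + 1)))

/-! ### The algorithm -/

/-- One step of JDP-Mirror with counter value `C` before the step: returns the new counter value and
the answer. Subtraction is truncated, so `C - K` is `max {0, C - K}`. -/
def step (π : ℕ → ℝ) (K C : ℕ) : Bool → PMF (ℕ × Bool)
  | true => (bern (π (C + 1 - K))).map fun r => (C + 1, r)
  | false => PMF.pure (C, false)

/-- The main loop of JDP-Mirror: the distribution of the answers to `T` inputs that are
processed one after the other, from counter value `C`. -/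
def run (π : ℕ → ℝ) (K : ℕ) : (T : ℕ) → (C : ℕ) → (Fin T → Bool) → PMF (Fin T → Bool)
  | 0, _, _ => PMF.pure Fin.elim0
  | T + 1, C, Δ =>
      (step π K C (Δ 0)).bind fun out =>
        (run π K T out.1 (Fin.tail Δ)).map fun rest => Fin.cons out.2 rest

/-- JDP-Mirror with delay `K`, run with the probabilities `π_{ε',δ'}`, over `T` time steps; the
counter starts at `0`. -/
def algorithm (ε' δ' : ℝ) (K T : ℕ) (Δ : Fin T → Bool) : PMF (Fin T → Bool) :=
  run (prob ε' δ') K T 0 Δ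

end

end JDPMirror

namespace JDPMirror

open Finset

noncomputable section

/-! The counter depends only on the input, so the answers are independent Bernoulli variables and
the output law is a product (`run_apply`). Removing output `i` deletes one factor. If the bit at `i`
changes from 0 to 1, each other factor either stays the same or moves from parameter `π k` to `π (k
+ 1)`, and the places `k` are distinct. Since `π` is monotone with values in `[0, 1]`, the parameter
changes sum to at most 1 (`IsLadder.sum_steps_le_one`).

The two jumps `0 → δ'` and `1 - δ' → 1` have no useful ratio bound; they are paid for in total
variation, `δ'` each (`sum_indicator_prodMass_le_add`). At every other changed factor the relative
change is at most `η = e^ε' - 1`, for both outcomes. The moment of order `n + 1` of its likelihood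
ratio is then at most `exp (2 (n + 1)² η |p - q|)`, because the first-order terms cancel and the
second-order ones are bounded by `η |p - q|` (`bern_moment_le`). This is linear in `|p - q|`, so the
product is at most `exp (2 (n + 1)² η)` however many factors change. A Markov argument with `n ≈ 3
log (1/δ) / ε` (`exists_moment`) makes the remaining error at most `δ / 2`.

Mistakes need a parameter below 1 at a counter value above `K`; there are at most `2L` such values,
and each is used once. -/

/-! ### Products of Bernoulli distributions -/

/-- The mass that the Bernoulli distribution with success probability `p` gives to a bit. -/
def bernMass (p : ℝ) : Bool → ℝ
  | true => p
  | false => 1 - p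

/-- The mass that a product of Bernoulli distributions gives to a vector of bits. -/
def prodMass {ι : Type*} [Fintype ι] (p : ι → ℝ) (z : ι → Bool) : ℝ :=
  ∏ j, bernMass (p j) (z j)

lemma bernMass_nonneg {p : ℝ} (h₀ : 0 ≤ p) (h₁ : p ≤ 1) (b : Bool) : 0 ≤ bernMass p b := by
  cases b <;> simp [bernMass] <;> linarith

lemma prodMass_nonneg {ι : Type*} [Fintype ι] {p : ι → ℝ} (h₀ : ∀ j, 0 ≤ p j)
    (h₁ : ∀ j, p j ≤ 1) (z : ι → Bool) : 0 ≤ prodMass p z :=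
  prod_nonneg fun j _ => bernMass_nonneg (h₀ j) (h₁ j) _

lemma sum_prod_bool {ι : Type*} [Fintype ι] [DecidableEq ι] (f : ι → Bool → ℝ) :
    ∑ z : ι → Bool, ∏ j, f j (z j) = ∏ j, (f j true + f j false) := by
  have h := prod_univ_sum (R := ℝ) (fun _ : ι => (univ : Finset Bool)) f
  simp only [Fintype.piFinset_univ, Fintype.sum_bool] at h
  exact h.symm

lemma one_sub_prod_one_sub_le {ι : Type*} (s : Finset ι) (d : ι → ℝ) (h₀ : ∀ j, 0 ≤ d j)
    (h₁ : ∀ j, d j ≤ 1) : 1 - ∏ j ∈ s, (1 - d j) ≤ ∑ j ∈ s, d j := by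
  classical
  induction s using Finset.induction_on with
  | empty => simp
  | insert a s ha ih =>
    rw [prod_insert ha, sum_insert ha]
    have h2 : ∏ j ∈ s, (1 - d j) ≤ 1 :=
      prod_le_one (fun j _ => by linarith [h₁ j]) fun j _ => by linarith [h₀ j]
    nlinarith [h₀ a, h₁ a]

/-- The total variation distance of products of Bernoulli distributions is at most the sum of the
distances of the factors. -/
lemma sum_indicator_prodMass_le_add {ι : Type*} [Fintype ι] [DecidableEq ι] (p q : ι → ℝ)
    (hp₀ : ∀ j, 0 ≤ p j) (hp₁ : ∀ j, p j ≤ 1) (hq₀ : ∀ j, 0 ≤ q j) (hq₁ : ∀ j, q j ≤ 1)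
    (A : Set (ι → Bool)) :
    ∑ z, A.indicator (prodMass p) z ≤ ∑ z, A.indicator (prodMass q) z + ∑ j, |p j - q j| := by
  -- The product of the factorwise minima lies below both masses and has total mass `∏ (1 - |p j - q
  -- j|)`; it is the common part of the coordinatewise maximal coupling.
  set m : (ι → Bool) → ℝ := fun z => ∏ j, min (bernMass (p j) (z j)) (bernMass (q j) (z j))
  have hmp : ∀ z, m z ≤ prodMass p z := fun z =>
    prod_le_prod (fun j _ => le_min (bernMass_nonneg (hp₀ j) (hp₁ j) _)
      (bernMass_nonneg (hq₀ j) (hq₁ j) _)) fun j _ => min_le_left _ _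
  have hmq : ∀ z, m z ≤ prodMass q z := fun z =>
    prod_le_prod (fun j _ => le_min (bernMass_nonneg (hp₀ j) (hp₁ j) _)
      (bernMass_nonneg (hq₀ j) (hq₁ j) _)) fun j _ => min_le_right _ _
  have hpt : ∀ z, A.indicator (prodMass p) z ≤
      A.indicator (prodMass q) z + (prodMass p z - m z) := by
    intro z
    by_cases hz : z ∈ A
    · simp only [Set.indicator_of_mem hz]; linarith [hmq z]
    · simp only [Set.indicator_of_notMem hz]; linarith [hmp z]
  have hsum := sum_le_sum fun z (_ : z ∈ (univ : Finset (ι → Bool))) => hpt z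
  rw [sum_add_distrib, sum_sub_distrib] at hsum
  have h1 : ∑ z, prodMass p z = 1 := by
    unfold prodMass
    rw [sum_prod_bool fun j b => bernMass (p j) b]
    simp [bernMass]
  have h2 : ∑ z, m z = ∏ j, (1 - |p j - q j|) := by
    rw [sum_prod_bool fun j b => min (bernMass (p j) b) (bernMass (q j) b)]
    refine prod_congr rfl fun j _ => ?_
    simp only [bernMass]
    rcases le_total (p j) (q j) with h | h
    · rw [min_eq_left h, min_eq_right (by linarith), abs_of_nonpos (by linarith)]; ring
    · rw [min_eq_right h, min_eq_left (by linarith), abs_of_nonneg (by linarith)]; ring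
  have h3 := one_sub_prod_one_sub_le univ (fun j => |p j - q j|) (fun j => abs_nonneg _)
    fun j => abs_le.2 ⟨by linarith [hp₀ j, hq₁ j], by linarith [hp₁ j, hq₀ j]⟩
  rw [h1, h2] at hsum
  linarith

/-! ### A moment bound -/

/-- Markov's inequality, pointwise: where `a > e^ε b`, the factor `(a / b)^n e^(-nε)` is at least 1.
The assumption `hab` covers `b = 0`, where the quotient may take the default value 0. -/
lemma le_exp_mul_add_moment {a b : ℝ} (ha : 0 ≤ a) (hb : 0 ≤ b) (hab : b = 0 → a = 0) (n : ℕ)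
    (ε : ℝ) :
    a ≤ Real.exp ε * b + Real.exp (-(n * ε)) * (a ^ (n + 1) / b ^ n) := by
  rcases hb.eq_or_lt with h | h
  · rw [hab h.symm, ← h]; simp
  rcases le_total a (Real.exp ε * b) with h1 | h1
  · have : 0 ≤ Real.exp (-(n * ε)) * (a ^ (n + 1) / b ^ n) := by positivity
    linarith
  · have h2 : (Real.exp ε * b) ^ n ≤ a ^ n := pow_le_pow_left₀ (by positivity) h1 n
    rw [mul_pow, ← Real.exp_nat_mul] at h2
    have h3 : a ≤ Real.exp (-(n * ε)) * (a ^ (n + 1) / b ^ n) := by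
      rw [Real.exp_neg, pow_succ, ← div_eq_inv_mul, div_div, le_div_iff₀ (by positivity)]
      nlinarith [mul_le_mul_of_nonneg_left h2 ha]
    have : 0 ≤ Real.exp ε * b := by positivity
    linarith

lemma one_add_pow_le {u : ℝ} (n : ℕ) (hu : -1 ≤ u) (hn : n * |u| ≤ 1) :
    (1 + u) ^ n ≤ 1 + n * u + (n * u) ^ 2 := by
  have h1 : (1 + u) ^ n ≤ Real.exp (n * u) := by
    rw [Real.exp_nat_mul]
    exact pow_le_pow_left₀ (by linarith) (by linarith [Real.add_one_le_exp u]) n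
  have h2 : |(n : ℝ) * u| ≤ 1 := by rwa [abs_mul, Nat.abs_cast]
  have h3 := (abs_le.1 (Real.abs_exp_sub_one_sub_id_le h2)).2
  linarith

/-- With `p = q (1 + u)`, expand `q (1 + u)^(n+1)` to second order for each outcome. The linear
terms of the two outcomes cancel, and `q u² = |u| |p - q| ≤ η |p - q|`; the two outcomes give the
factor `2η`. -/
lemma bern_moment_le {p q η : ℝ} (n : ℕ) (hp₀ : 0 ≤ p) (hp₁ : p ≤ 1) (hq₀ : 0 < q) (hq₁ : q < 1)
    (h1 : |p - q| ≤ η * q) (h2 : |p - q| ≤ η * (1 - q)) (hn : (n + 1) * η ≤ 1) :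
    p ^ (n + 1) / q ^ n + (1 - p) ^ (n + 1) / (1 - q) ^ n ≤
      Real.exp ((n + 1) ^ 2 * (2 * η) * |p - q|) := by
  have key : ∀ x y : ℝ, 0 ≤ x → 0 < y → |x - y| ≤ η * y →
      x ^ (n + 1) / y ^ n ≤ y + (n + 1) * (x - y) + (n + 1) ^ 2 * η * |x - y| := by
    intro x y hx hy hxy
    have hu : |(x - y) / y| ≤ η := by rw [abs_div, abs_of_pos hy, div_le_iff₀ hy]; exact hxy
    have hb := one_add_pow_le (u := (x - y) / y) (n + 1)
      (by rw [le_div_iff₀ hy]; linarith)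
      (by push_cast; exact (mul_le_mul_of_nonneg_left hu (by positivity)).trans hn)
    have e1 : x ^ (n + 1) / y ^ n = y * (1 + (x - y) / y) ^ (n + 1) := by
      have : 1 + (x - y) / y = x / y := by field_simp; ring
      rw [this, div_pow, pow_succ y]; field_simp
    have e2 : y * ((x - y) / y) ^ 2 = |(x - y) / y| * |x - y| := by
      rw [abs_div, abs_of_pos hy, ← sq_abs ((x - y) / y), abs_div, abs_of_pos hy]; field_simp
    have e3 : |(x - y) / y| * |x - y| ≤ η * |x - y| :=
      mul_le_mul_of_nonneg_right hu (abs_nonneg _)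
    rw [e1]
    calc y * (1 + (x - y) / y) ^ (n + 1)
        ≤ y * (1 + ((n + 1 : ℕ) : ℝ) * ((x - y) / y) + (((n + 1 : ℕ) : ℝ) * ((x - y) / y)) ^ 2) :=
          mul_le_mul_of_nonneg_left hb hy.le
      _ = y + (n + 1) * (x - y) + (n + 1) ^ 2 * (y * ((x - y) / y) ^ 2) := by
          push_cast; field_simp
      _ ≤ _ := by
          rw [e2, mul_assoc]
          have : (0 : ℝ) ≤ (n + 1) ^ 2 := by positivity
          linarith [mul_le_mul_of_nonneg_left e3 this]
  have k1 := key p q hp₀ hq₀ h1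
  have e : |(1 - p) - (1 - q)| = |p - q| := by rw [← abs_neg]; congr 1; ring
  have k2 := key (1 - p) (1 - q) (by linarith) (by linarith) (by rw [e]; exact h2)
  rw [e] at k2
  have := Real.add_one_le_exp ((n + 1) ^ 2 * (2 * η) * |p - q|)
  linarith

/-- Treats the unchanged factors, where the parameter may be 0 or 1 and `bern_moment_le` does not
apply. -/
lemma bern_moment_self_le {p : ℝ} (n : ℕ) :
    p ^ (n + 1) / p ^ n + (1 - p) ^ (n + 1) / (1 - p) ^ n = 1 := by
  have key : ∀ x : ℝ, x ^ (n + 1) / x ^ n = x := by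
    intro x
    rcases eq_or_ne x 0 with rfl | h
    · simp
    · rw [pow_succ]; field_simp
  rw [key, key]; ring

/-- Composition: products of Bernoulli distributions whose factors are pairwise close in ratio are
indistinguishable, with an error controlled by the sum of the distances of the factors. -/
lemma sum_indicator_prodMass_le_exp {ι : Type*} [Fintype ι] [DecidableEq ι] (p q : ι → ℝ) (η ε : ℝ) (n : ℕ)
    (hp₀ : ∀ j, 0 ≤ p j) (hp₁ : ∀ j, p j ≤ 1) (hq₀ : ∀ j, 0 ≤ q j) (hq₁ : ∀ j, q j ≤ 1)
    (hη : 0 ≤ η) (hn : (n + 1) * η ≤ 1)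
    (hpq : ∀ j, p j ≠ q j →
      0 < q j ∧ q j < 1 ∧ |p j - q j| ≤ η * q j ∧ |p j - q j| ≤ η * (1 - q j))
    (hsum : ∑ j, |p j - q j| ≤ 1) (A : Set (ι → Bool)) :
    ∑ z, A.indicator (prodMass p) z ≤
      Real.exp ε * ∑ z, A.indicator (prodMass q) z +
        Real.exp ((n + 1) ^ 2 * (2 * η) - n * ε) := by
  have habs : ∀ z, prodMass q z = 0 → prodMass p z = 0 := by
    intro z hz
    obtain ⟨j, _, hj⟩ := prod_eq_zero_iff.1 hz
    refine prod_eq_zero (mem_univ j) ?_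
    by_cases h : p j = q j
    · rw [h, hj]
    · obtain ⟨a, b, _⟩ := hpq j h
      cases hb : z j <;> simp only [hb, bernMass] at hj <;> linarith
  have hpt : ∀ z, A.indicator (prodMass p) z ≤ Real.exp ε * A.indicator (prodMass q) z +
      Real.exp (-(n * ε)) * (prodMass p z ^ (n + 1) / prodMass q z ^ n) := by
    intro z
    have hp := prodMass_nonneg hp₀ hp₁ z
    have hq := prodMass_nonneg hq₀ hq₁ z
    by_cases hz : z ∈ A
    · simp only [Set.indicator_of_mem hz]
      exact le_exp_mul_add_moment hp hq (habs z) n ε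
    · simp only [Set.indicator_of_notMem hz]
      positivity
  have h := sum_le_sum fun z (_ : z ∈ (univ : Finset (ι → Bool))) => hpt z
  rw [sum_add_distrib, ← mul_sum, ← mul_sum] at h
  have hm : ∑ z, prodMass p z ^ (n + 1) / prodMass q z ^ n ≤ Real.exp ((n + 1) ^ 2 * (2 * η)) := by
    simp only [prodMass, ← prod_pow, ← prod_div_distrib]
    rw [sum_prod_bool fun j b => bernMass (p j) b ^ (n + 1) / bernMass (q j) b ^ n]
    calc ∏ j, (bernMass (p j) true ^ (n + 1) / bernMass (q j) true ^ n +
            bernMass (p j) false ^ (n + 1) / bernMass (q j) false ^ n)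
        ≤ ∏ j, Real.exp ((n + 1) ^ 2 * (2 * η) * |p j - q j|) := by
          refine prod_le_prod (fun j _ => ?_) fun j _ => ?_
          · have h1 := bernMass_nonneg (hp₀ j) (hp₁ j)
            have h2 := bernMass_nonneg (hq₀ j) (hq₁ j)
            have := h1 true; have := h1 false; have := h2 true; have := h2 false
            positivity
          · by_cases h : p j = q j
            · simp only [bernMass, h, bern_moment_self_le]; simp
            · obtain ⟨a, b, c, d⟩ := hpq j h
              exact bern_moment_le n (hp₀ j) (hp₁ j) a b c d hn
      _ = Real.exp ((n + 1) ^ 2 * (2 * η) * ∑ j, |p j - q j|) := by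
          rw [← Real.exp_sum, mul_sum]
      _ ≤ _ := Real.exp_le_exp.2 (mul_le_of_le_one_right (by positivity) hsum)
  have e : Real.exp ((n + 1) ^ 2 * (2 * η) - n * ε) =
      Real.exp (-(n * ε)) * Real.exp ((n + 1) ^ 2 * (2 * η)) := by
    rw [← Real.exp_add]; ring_nf
  rw [e]
  exact h.trans (by gcongr)

/-! ### The output distribution of JDP-Mirror -/

lemma bern_apply {p : ℝ} (h₀ : 0 ≤ p) (h₁ : p ≤ 1) (b : Bool) :
    bern p b = ENNReal.ofReal (bernMass p b) := by
  rw [bern, MeasureTheory.Measure.toPMF_apply, Set.projIcc_of_mem _ (⟨h₀, h₁⟩ : p ∈ Set.Icc 0 1),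
    ProbabilityTheory.bernoulliMeasure_apply _ (measurableSet_singleton b)]
  cases b <;> simp [bernMass, ENNReal.ofReal, Real.toNNReal_of_nonneg, h₀, h₁] <;> rfl

/-- The success probabilities of the answers to the input `Δ`, from counter value `C`. -/
def answerProb (π : ℕ → ℝ) (K C : ℕ) {T : ℕ} (Δ : Fin T → Bool) (t : Fin T) : ℝ :=
  if Δ t = true then π (C + onesUpTo Δ t - K) else 0

lemma onesUpTo_eq_sum {T : ℕ} (Δ : Fin T → Bool) (t : Fin T) :
    onesUpTo Δ t = ∑ s, if s ≤ t ∧ Δ s = true then 1 else 0 := by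
  rw [onesUpTo, card_filter]

lemma onesUpTo_zero {T : ℕ} (Δ : Fin (T + 1) → Bool) :
    onesUpTo Δ 0 = if Δ 0 = true then 1 else 0 := by
  rw [onesUpTo_eq_sum, Fin.sum_univ_succ]
  simp

lemma onesUpTo_succ {T : ℕ} (Δ : Fin (T + 1) → Bool) (t : Fin T) :
    onesUpTo Δ t.succ = (if Δ 0 = true then 1 else 0) + onesUpTo (Fin.tail Δ) t := by
  rw [onesUpTo_eq_sum, onesUpTo_eq_sum, Fin.sum_univ_succ]
  simp only [Fin.tail, Fin.succ_le_succ_iff, Fin.zero_le, true_and]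
  exact congrArg _ (sum_congr rfl fun s _ => if_congr Iff.rfl rfl rfl)

lemma map_cons_apply {T : ℕ} (P : PMF (Fin T → Bool)) (b : Bool) (y : Fin (T + 1) → Bool) :
    (P.map fun rest => (Fin.cons b rest : Fin (T + 1) → Bool)) y =
      if y 0 = b then P (Fin.tail y) else 0 := by
  rw [PMF.map_apply]
  split_ifs with h
  · rw [tsum_eq_single (Fin.tail y)]
    · rw [if_pos]; rw [← h, Fin.cons_self_tail]
    · intro z hz
      rw [if_neg]
      rintro rfl
      exact hz (Fin.tail_cons (α := fun _ => Bool) b z).symm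
  · rw [ENNReal.tsum_eq_zero]
    intro z
    rw [if_neg]
    rintro rfl
    exact h (Fin.cons_zero _ _)

lemma run_apply {π : ℕ → ℝ} (h₀ : ∀ i, 0 ≤ π i) (h₁ : ∀ i, π i ≤ 1) (K T C : ℕ)
    (Δ y : Fin T → Bool) :
    run π K T C Δ y = ENNReal.ofReal (prodMass (answerProb π K C Δ) y) := by
  induction T generalizing C with
  | zero =>
    have : y = Fin.elim0 := Subsingleton.elim _ _
    simp [run, prodMass, this]
  | succ T ih =>
    -- Both values of the first bit use this factorisation; `C'` is the counter after the first
    -- step.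
    have hs : ∀ C', C' = C + (if Δ 0 = true then 1 else 0) →
        ENNReal.ofReal (prodMass (answerProb π K C Δ) y) =
        ENNReal.ofReal (bernMass (answerProb π K C Δ 0) (y 0)) *
          run π K T C' (Fin.tail Δ) (Fin.tail y) := by
      rintro C' rfl
      rw [ih, ← ENNReal.ofReal_mul, prodMass, Fin.prod_univ_succ]
      · congr 2
        refine prod_congr rfl fun t _ => ?_
        congr 1
        simp only [answerProb, onesUpTo_succ, Fin.tail, add_assoc]
      · refine bernMass_nonneg ?_ ?_ _ <;> unfold answerProb <;> split_ifs <;>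
          first | exact h₀ _ | exact h₁ _ | norm_num
    cases hΔ : Δ 0 with
    | false =>
      rw [hs C (by simp [hΔ]), run, hΔ, step, PMF.pure_bind, map_cons_apply]
      cases hy : y 0 <;> simp [answerProb, hΔ, bernMass]
    | true =>
      rw [hs (C + 1) (by simp [hΔ]), run, hΔ, step, PMF.bind_map, PMF.bind_apply, tsum_bool]
      simp only [Function.comp, map_cons_apply, bern_apply (h₀ _) (h₁ _)]
      have : answerProb π K C Δ 0 = π (C + 1 - K) := by simp [answerProb, hΔ, onesUpTo_zero]
      rw [this]
      cases hy : y 0 <;> simp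

lemma answerProb_nonneg {π : ℕ → ℝ} (h₀ : ∀ i, 0 ≤ π i) (K C : ℕ) {T : ℕ} (Δ : Fin T → Bool)
    (t : Fin T) : 0 ≤ answerProb π K C Δ t := by
  unfold answerProb; split_ifs; exacts [h₀ _, le_rfl]

lemma answerProb_le_one {π : ℕ → ℝ} (h₁ : ∀ i, π i ≤ 1) (K C : ℕ) {T : ℕ} (Δ : Fin T → Bool)
    (t : Fin T) : answerProb π K C Δ t ≤ 1 := by
  unfold answerProb; split_ifs; exacts [h₁ _, zero_le_one]

/-! ### Validity and mistakes -/

lemma onesUpTo_lt {T : ℕ} {Δ : Fin T → Bool} {s t : Fin T} (hst : s < t) (ht : Δ t = true) :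
    onesUpTo Δ s < onesUpTo Δ t := by
  refine card_lt_card (ssubset_iff_of_subset ?_ |>.2 ⟨t, ?_, ?_⟩)
  · intro x
    simp only [mem_filter, mem_univ, true_and]
    exact fun h => ⟨h.1.trans hst.le, h.2⟩
  · simp [ht]
  · simp [hst]

lemma onesUpTo_injOn {T : ℕ} (Δ : Fin T → Bool) :
    Set.InjOn (onesUpTo Δ) {t | Δ t = true} := by
  intro s hs t ht h
  rcases lt_trichotomy s t with h' | h' | h'
  · exact absurd h (onesUpTo_lt h' ht).ne
  · exact h'
  · exact absurd h (onesUpTo_lt h' hs).ne'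

lemma onesUpTo_eq_onesBefore_add_one {T : ℕ} {Δ : Fin T → Bool} {t : Fin T} (ht : Δ t = true) :
    onesUpTo Δ t = onesBefore Δ t + 1 := by
  have : (univ.filter fun s : Fin T => s ≤ t ∧ Δ s = true) =
      insert t (univ.filter fun s : Fin T => s < t ∧ Δ s = true) := by
    ext s
    simp only [mem_filter, mem_univ, true_and, mem_insert, le_iff_eq_or_lt]
    constructor
    · tauto
    · rintro (rfl | h)
      · exact ⟨Or.inl rfl, ht⟩
      · exact ⟨Or.inr h.1, h.2⟩
  rw [onesUpTo, this, card_insert_of_notMem (by simp), onesBefore]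

lemma bernMass_ne_zero_of_mem_support {π : ℕ → ℝ} (h₀ : ∀ i, 0 ≤ π i) (h₁ : ∀ i, π i ≤ 1)
    {K T C : ℕ} {Δ y : Fin T → Bool} (hy : y ∈ (run π K T C Δ).support) (t : Fin T) :
    bernMass (answerProb π K C Δ t) (y t) ≠ 0 := by
  rw [PMF.mem_support_iff, run_apply h₀ h₁] at hy
  intro h
  exact hy (by rw [prodMass, prod_eq_zero (mem_univ t) h, ENNReal.ofReal_zero])

lemma isValidMirror_of_mem_support {π : ℕ → ℝ} (h₀ : ∀ i, 0 ≤ π i) (h₁ : ∀ i, π i ≤ 1)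
    (hz : π 0 = 0) {K T : ℕ} {Δ y : Fin T → Bool} (hy : y ∈ (run π K T 0 Δ).support) :
    IsValidMirror K Δ y := by
  intro t
  have ht := bernMass_ne_zero_of_mem_support h₀ h₁ hy t
  have hf : Δ t = false → y t = false := by
    intro h
    by_contra hb
    rw [Bool.not_eq_false] at hb
    simp [answerProb, h, hb, bernMass] at ht
  refine ⟨hf, fun hb => ?_⟩
  have hΔ : Δ t = true := by
    by_contra h
    rw [hf (by simpa using h)] at hb
    simp at hb
  simp only [answerProb, hΔ, hb, bernMass, if_true, zero_add] at ht
  by_contra hK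
  rw [onesUpTo_eq_onesBefore_add_one hΔ, Nat.sub_eq_zero_of_le (by omega)] at ht
  exact ht hz

lemma mistakes_le_of_mem_support {π : ℕ → ℝ} (h₀ : ∀ i, 0 ≤ π i) (h₁ : ∀ i, π i ≤ 1) {N : ℕ}
    (hN : ∀ i, N < i → π i = 1) {K T : ℕ} {Δ y : Fin T → Bool}
    (hy : y ∈ (run π K T 0 Δ).support) : mistakes K Δ y ≤ N := by
  have hmaps : ∀ t ∈ univ.filter fun t : Fin T => Δ t = true ∧ K < onesUpTo Δ t ∧ y t = false,
      onesUpTo Δ t ∈ Finset.Ioc K (K + N) := by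
    intro t ht
    simp only [mem_filter, mem_univ, true_and] at ht
    obtain ⟨hΔ, hK, hb⟩ := ht
    have h := bernMass_ne_zero_of_mem_support h₀ h₁ hy t
    simp only [answerProb, hΔ, hb, bernMass, if_true, zero_add] at h
    rw [Finset.mem_Ioc]
    refine ⟨hK, ?_⟩
    by_contra hc
    exact h (by rw [hN _ (by omega), sub_self])
  have := card_le_card_of_injOn (onesUpTo Δ) hmaps
    ((onesUpTo_injOn Δ).mono fun t ht => by simp at ht; exact ht.1)
  rwa [Nat.card_Ioc, Nat.add_sub_cancel_left] at this

/-! ### Removing one output -/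

lemma toOuterMeasure_map_dropCoord_run {π : ℕ → ℝ} (h₀ : ∀ i, 0 ≤ π i) (h₁ : ∀ i, π i ≤ 1)
    (K T C : ℕ) (Δ : Fin T → Bool) (i : Fin T) (A : Set ({j : Fin T // j ≠ i} → Bool)) :
    ((run π K T C Δ).map (dropCoord i)).toOuterMeasure A =
      ENNReal.ofReal (∑ z, A.indicator (prodMass fun j => answerProb π K C Δ j) z) := by
  classical
  have hn := fun z => prodMass_nonneg (answerProb_nonneg h₀ K C Δ) (answerProb_le_one h₁ K C Δ) z
  have e : ∀ y, (dropCoord i ⁻¹' A).indicator (run π K T C Δ) y =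
      ENNReal.ofReal ((dropCoord i ⁻¹' A).indicator (prodMass (answerProb π K C Δ)) y) := by
    intro y
    by_cases h : y ∈ dropCoord i ⁻¹' A
    · rw [Set.indicator_of_mem h, Set.indicator_of_mem h, run_apply h₀ h₁]
    · rw [Set.indicator_of_notMem h, Set.indicator_of_notMem h, ENNReal.ofReal_zero]
  rw [PMF.toOuterMeasure_map_apply, PMF.toOuterMeasure_apply, tsum_fintype]
  simp only [e]
  rw [← ENNReal.ofReal_sum_of_nonneg fun y _ => Set.indicator_nonneg (fun y _ => hn y) y]
  congr 1
  -- Summing over the bit at `i` first removes its factor, whose two masses add up to 1.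
  rw [← (Equiv.funSplitAt i Bool).symm.sum_comp, Fintype.sum_prod_type, sum_comm]
  refine sum_congr rfl fun z _ => ?_
  have hd : ∀ b, dropCoord i ((Equiv.funSplitAt i Bool).symm (b, z)) = z := by
    intro b; ext j; simp [dropCoord, j.2]
  have hb : ∀ b, prodMass (answerProb π K C Δ) ((Equiv.funSplitAt i Bool).symm (b, z)) =
      bernMass (answerProb π K C Δ i) b *
        prodMass (fun j : {j // j ≠ i} => answerProb π K C Δ j) z := by
    intro b
    rw [prodMass, Fintype.prod_eq_mul_prod_subtype_ne _ i, prodMass]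
    congr 1
    · simp
    · refine prod_congr rfl fun j _ => ?_
      simp [j.2]
  by_cases hz : z ∈ A
  · have : ∀ b, (Equiv.funSplitAt i Bool).symm (b, z) ∈ dropCoord i ⁻¹' A := fun b => by
      rw [Set.mem_preimage, hd]; exact hz
    simp only [Set.indicator_of_mem (this _), Set.indicator_of_mem hz, Fintype.sum_bool, hb,
      bernMass]
    ring
  · have : ∀ b, (Equiv.funSplitAt i Bool).symm (b, z) ∉ dropCoord i ⁻¹' A := fun b => by
      rw [Set.mem_preimage, hd]; exact hz
    simp [Set.indicator_of_notMem (this _), Set.indicator_of_notMem hz]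

/-! ### Privacy of one shift along a ladder of probabilities -/

/-- A sequence that increases from `0` to `1`, with jumps `δ` after the index `0` and after the
index `N`, and steps of bounded ratio in between. -/
structure IsLadder (π : ℕ → ℝ) (N : ℕ) (ε δ : ℝ) : Prop where
  mono : Monotone π
  zero : π 0 = 0
  first : π 1 = δ
  last : π N = 1 - δ
  top : ∀ i, N < i → π i = 1
  ratio : ∀ i, 1 ≤ i → i < N → π (i + 1) ≤ Real.exp ε * π i
  ratio_compl : ∀ i, 1 ≤ i → i < N → 1 - π i ≤ Real.exp ε * (1 - π (i + 1))

namespace IsLadder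

variable {π : ℕ → ℝ} {N : ℕ} {ε δ : ℝ}

lemma nonneg (h : IsLadder π N ε δ) (i : ℕ) : 0 ≤ π i :=
  h.zero ▸ h.mono (Nat.zero_le i)

lemma le_one (h : IsLadder π N ε δ) (i : ℕ) : π i ≤ 1 := by
  rw [← h.top (i + N + 1) (by omega)]
  exact h.mono (by omega)

lemma pos (h : IsLadder π N ε δ) (hδ : 0 < δ) {i : ℕ} (hi : 1 ≤ i) : 0 < π i :=
  hδ.trans_le (h.first ▸ h.mono hi)

lemma lt_one (h : IsLadder π N ε δ) (hδ : 0 < δ) {i : ℕ} (hi : i ≤ N) : π i < 1 := by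
  have := h.mono hi
  rw [h.last] at this
  linarith

/-- Distinct steps of a monotone sequence are part of a telescoping sum, which is bounded by the
range of `π`. -/
lemma sum_steps_le_one (h : IsLadder π N ε δ) {ι : Type*} (J : Finset ι) (k : ι → ℕ)
    (hk : Set.InjOn k J) : ∑ j ∈ J, (π (k j + 1) - π (k j)) ≤ 1 := by
  classical
  rw [← sum_image (f := fun m => π (m + 1) - π m) hk]
  have hsub : J.image k ⊆ range ((J.image k).sup id + 1) := fun m hm =>
    mem_range.2 (Nat.lt_succ_of_le (le_sup (f := id) hm))
  refine (sum_le_sum_of_subset_of_nonneg hsub fun m _ _ =>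
    sub_nonneg.2 (h.mono m.le_succ)).trans ?_
  rw [sum_range_sub]
  linarith [h.le_one ((J.image k).sup id + 1), h.zero]

/-- Products of Bernoulli distributions whose parameters differ by one step at distinct places of
a ladder are indistinguishable. -/
lemma sum_indicator_prodMass_le (h : IsLadder π N ε δ) (hδ : 0 < δ) (hε : 0 ≤ ε)
    {ι : Type*} [Fintype ι] [DecidableEq ι] {p q : ι → ℝ}
    (hp₀ : ∀ j, 0 ≤ p j) (hp₁ : ∀ j, p j ≤ 1) (hq₀ : ∀ j, 0 ≤ q j) (hq₁ : ∀ j, q j ≤ 1)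
    {J : Finset ι} {k : ι → ℕ} (hk : Set.InjOn k J)
    (hJ : ∀ j ∈ J, (p j = π (k j) ∧ q j = π (k j + 1)) ∨ (p j = π (k j + 1) ∧ q j = π (k j)))
    (hJ' : ∀ j ∉ J, p j = q j) {n : ℕ} (hn : (n + 1) * (Real.exp ε - 1) ≤ 1) (ε₀ : ℝ)
    (A : Set (ι → Bool)) :
    ∑ z, A.indicator (prodMass p) z ≤
      Real.exp ε₀ * ∑ z, A.indicator (prodMass q) z +
        (Real.exp ((n + 1) ^ 2 * (2 * (Real.exp ε - 1)) - n * ε₀) + 2 * δ) := by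
  have hE : 1 ≤ Real.exp ε := Real.one_le_exp hε
  -- `S` collects the at most two coordinates at the exceptional jumps, and `p'` is a hybrid that
  -- already agrees with `q` there. Passing from `p` to `p'` costs `2 * δ` in total variation; from
  -- `p'` to `q` only bounded-ratio steps remain.
  set S := J.filter fun j => k j ∈ ({0, N} : Finset ℕ) with hS
  set p' : ι → ℝ := fun j => if j ∈ S then q j else p j with hp'
  have habs : ∀ j ∈ J, |p j - q j| = π (k j + 1) - π (k j) := by
    intro j hj
    have := h.mono (k j).le_succ
    rcases hJ j hj with ⟨h1, h2⟩ | ⟨h1, h2⟩ <;> rw [h1, h2]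
    · rw [abs_sub_comm, abs_of_nonneg (sub_nonneg.2 this)]
    · rw [abs_of_nonneg (sub_nonneg.2 this)]
  have hp'₀ : ∀ j, 0 ≤ p' j := fun j => by
    simp only [hp']; split_ifs; exacts [hq₀ j, hp₀ j]
  have hp'₁ : ∀ j, p' j ≤ 1 := fun j => by
    simp only [hp']; split_ifs; exacts [hq₁ j, hp₁ j]
  have hTV : ∑ j, |p j - p' j| ≤ 2 * δ := by
    have h1 : ∀ j, |p j - p' j| = if j ∈ S then δ else 0 := by
      intro j
      simp only [hp']
      split_ifs with hj
      · rw [hS, mem_filter, mem_insert, mem_singleton] at hj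
        rw [habs j hj.1]
        rcases hj.2 with h2 | h2 <;> rw [h2]
        · rw [zero_add, h.zero, h.first, sub_zero]
        · rw [h.top _ N.lt_succ_self, h.last]; ring
      · simp
    have h2 : S.card ≤ 2 :=
      (card_le_card_of_injOn k (fun j hj => (mem_filter.1 hj).2)
        (hk.mono fun j hj => (mem_filter.1 hj).1)).trans card_le_two
    rw [sum_congr rfl fun j _ => h1 j, sum_ite_mem, univ_inter, sum_const, nsmul_eq_mul]
    have : (S.card : ℝ) ≤ 2 := by exact_mod_cast h2
    exact mul_le_mul_of_nonneg_right this hδ.le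
  have hsum : ∑ j, |p' j - q j| ≤ 1 := by
    refine le_trans ?_ (h.sum_steps_le_one J k hk)
    rw [← univ_inter J, ← sum_ite_mem]
    refine sum_le_sum fun j _ => ?_
    simp only [hp']
    split_ifs with h1 h2 h2
    · rw [sub_self, abs_zero]; exact sub_nonneg.2 (h.mono (k j).le_succ)
    · exact absurd (mem_filter.1 h1).1 h2
    · exact (habs j h2).le
    · rw [hJ' j h2, sub_self, abs_zero]
  have hpq : ∀ j, p' j ≠ q j → 0 < q j ∧ q j < 1 ∧ |p' j - q j| ≤ (Real.exp ε - 1) * q j ∧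
      |p' j - q j| ≤ (Real.exp ε - 1) * (1 - q j) := by
    intro j hne
    have hjS : j ∉ S := fun hj => hne (by simp only [hp', if_pos hj])
    have e : p' j = p j := by simp only [hp', if_neg hjS]
    rw [e] at hne ⊢
    have hjJ : j ∈ J := by
      by_contra hj
      exact hne (hJ' j hj)
    rw [hS, mem_filter, mem_insert, mem_singleton] at hjS
    have hkN : k j < N := by
      -- Above `N` both parameters are 1, so a coordinate that changes cannot lie there.
      by_contra hc
      have h1 : N < k j := lt_of_le_of_ne (not_lt.1 hc) fun h1 => hjS ⟨hjJ, Or.inr h1.symm⟩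
      have h2 := h.top _ h1
      have h3 := h.top (k j + 1) (by omega)
      rcases hJ j hjJ with ⟨h4, h5⟩ | ⟨h4, h5⟩ <;> exact hne (by rw [h4, h5, h2, h3])
    have hk1 : 1 ≤ k j := Nat.one_le_iff_ne_zero.2 fun h1 => hjS ⟨hjJ, Or.inl h1⟩
    rw [habs j hjJ]
    have r1 := h.ratio _ hk1 hkN
    have r2 := h.ratio_compl _ hk1 hkN
    have a1 := h.pos hδ hk1
    have a2 := h.pos hδ (hk1.trans (k j).le_succ)
    have b1 := h.lt_one hδ hkN.le
    have b2 := h.lt_one hδ (Nat.succ_le_of_lt hkN)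
    have m := h.mono (k j).le_succ
    simp only [Nat.succ_eq_add_one] at *
    rcases hJ j hjJ with ⟨-, h5⟩ | ⟨-, h5⟩ <;> rw [h5] <;>
      refine ⟨by assumption, by assumption, ?_, ?_⟩ <;> nlinarith
  have m1 := sum_indicator_prodMass_le_add p p' hp₀ hp₁ hp'₀ hp'₁ A
  have m2 := sum_indicator_prodMass_le_exp p' q (Real.exp ε - 1) ε₀ n hp'₀ hp'₁ hq₀ hq₁
    (by linarith) hn hpq hsum A
  linarith

end IsLadder

/-! ### From one shift to joint differential privacy -/

lemma Indist.symm {Ω : Type*} {ε δ : ℝ} {P Q : PMF Ω} (h : Indist ε δ P Q) : Indist ε δ Q P :=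
  fun S => ⟨(h S).2, (h S).1⟩

lemma Indist.refl {Ω : Type*} {ε : ℝ} (hε : 0 ≤ ε) (δ : ℝ) (P : PMF Ω) : Indist ε δ P P := by
  have key : ∀ S : Set Ω, P.toOuterMeasure S ≤
      ENNReal.ofReal (Real.exp ε) * P.toOuterMeasure S + ENNReal.ofReal δ := fun S =>
    (le_mul_of_one_le_left zero_le (ENNReal.one_le_ofReal.2 (Real.one_le_exp hε))).trans
      le_self_add
  exact fun S => ⟨key S, key S⟩

lemma onesUpTo_eq_of_differ {T : ℕ} {S S' : Fin T → Bool} {i : Fin T}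
    (hS : ∀ j, j ≠ i → S j = S' j) (hi : S i = false) (hi' : S' i = true) (t : Fin T) :
    onesUpTo S' t = onesUpTo S t + if i ≤ t then 1 else 0 := by
  rw [onesUpTo_eq_sum, onesUpTo_eq_sum, ← sum_erase_add _ _ (mem_univ i),
    ← sum_erase_add univ (fun s => if s ≤ t ∧ S s = true then 1 else 0) (mem_univ i)]
  simp only [hi, hi', and_true, Bool.false_eq_true, and_false, if_false, add_zero]
  congr 1
  refine sum_congr rfl fun s hs => ?_
  rw [hS s (ne_of_mem_erase hs)]

/-- JDP-Mirror, run with a ladder of probabilities, is jointly differentially private. -/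
lemma isJDP_run {π : ℕ → ℝ} {N : ℕ} {ε' δ' : ℝ} (h : IsLadder π N ε' δ') (hδ' : 0 < δ')
    (hε' : 0 ≤ ε') {ε δ : ℝ} (hε : 0 ≤ ε) (n : ℕ)
    (hn : (n + 1) * (Real.exp ε' - 1) ≤ 1)
    (hδ : Real.exp ((n + 1) ^ 2 * (2 * (Real.exp ε' - 1)) - n * ε) + 2 * δ' ≤ δ) (K T : ℕ) :
    IsJDP (run π K T 0) ε δ := by
  have key : ∀ (i : Fin T) (S S' : Fin T → Bool), (∀ j, j ≠ i → S j = S' j) → S i = false →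
      S' i = true →
      Indist ε δ ((run π K T 0 S).map (dropCoord i)) ((run π K T 0 S').map (dropCoord i)) := by
    intro i S S' hS hi hi'
    set p : {j // j ≠ i} → ℝ := fun j => answerProb π K 0 S j with hp
    set q : {j // j ≠ i} → ℝ := fun j => answerProb π K 0 S' j with hq
    have hp₀ : ∀ j, 0 ≤ p j := fun j => answerProb_nonneg h.nonneg K 0 S j
    have hp₁ : ∀ j, p j ≤ 1 := fun j => answerProb_le_one h.le_one K 0 S j
    have hq₀ : ∀ j, 0 ≤ q j := fun j => answerProb_nonneg h.nonneg K 0 S' j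
    have hq₁ : ∀ j, q j ≤ 1 := fun j => answerProb_le_one h.le_one K 0 S' j
    -- The coordinates whose ladder index really moves. If `onesUpTo S j < K`, truncated subtraction
    -- gives index 0 before and after the extra 1; equality with `K` gives the jump from `π 0` to `π
    -- 1`.
    set J : Finset {j // j ≠ i} :=
      univ.filter fun j => S j = true ∧ i ≤ j.1 ∧ K ≤ onesUpTo S j.1 with hJ
    set k : {j // j ≠ i} → ℕ := fun j => onesUpTo S j.1 - K with hk
    have hinj : Set.InjOn k J := by
      intro a ha b hb hab
      simp only [hJ, coe_filter, mem_univ, true_and, Set.mem_ofPred_eq] at ha hb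
      refine Subtype.ext (onesUpTo_injOn S ha.1 hb.1 ?_)
      simp only [hk] at hab
      omega
    have h1 : ∀ j ∈ J, p j = π (k j) ∧ q j = π (k j + 1) := by
      intro j hj
      rw [hJ, mem_filter] at hj
      obtain ⟨-, hj1, hj2, hj3⟩ := hj
      simp only [hp, hq, answerProb, ← hS j j.2, if_pos hj1, onesUpTo_eq_of_differ hS hi hi',
        if_pos hj2, zero_add, true_and, hk]
      congr 1
      omega
    have h2 : ∀ j ∉ J, p j = q j := by
      intro j hj
      simp only [hJ, mem_filter, mem_univ, true_and, not_and, not_le] at hj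
      simp only [hp, hq, answerProb, ← hS j j.2]
      split_ifs with hj1
      · rw [onesUpTo_eq_of_differ hS hi hi']
        split_ifs with hj2
        · have := hj hj1 hj2
          congr 1
          omega
        · rfl
      · rfl
    intro A
    rw [toOuterMeasure_map_dropCoord_run h.nonneg h.le_one,
      toOuterMeasure_map_dropCoord_run h.nonneg h.le_one]
    have b1 := h.sum_indicator_prodMass_le hδ' hε' hp₀ hp₁ hq₀ hq₁ hinj
      (fun j hj => Or.inl (h1 j hj)) h2 hn ε A
    have b2 := h.sum_indicator_prodMass_le hδ' hε' hq₀ hq₁ hp₀ hp₁ hinj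
      (fun j hj => Or.inr (h1 j hj).symm) (fun j hj => (h2 j hj).symm) hn ε A
    have n1 : 0 ≤ ∑ z, A.indicator (prodMass p) z := sum_nonneg fun z _ =>
      Set.indicator_nonneg (fun z _ => prodMass_nonneg hp₀ hp₁ z) z
    have n2 : 0 ≤ ∑ z, A.indicator (prodMass q) z := sum_nonneg fun z _ =>
      Set.indicator_nonneg (fun z _ => prodMass_nonneg hq₀ hq₁ z) z
    have hδ₀ : 0 ≤ δ := le_trans (by positivity) hδ
    have e := (Real.exp_pos ε).le
    rw [← ENNReal.ofReal_mul e, ← ENNReal.ofReal_add (mul_nonneg e n2) hδ₀,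
      ← ENNReal.ofReal_mul e, ← ENNReal.ofReal_add (mul_nonneg e n1) hδ₀]
    exact ⟨ENNReal.ofReal_le_ofReal (by linarith), ENNReal.ofReal_le_ofReal (by linarith)⟩
  intro i S S' hS
  cases hi : S i <;> cases hi' : S' i
  · rw [show S = S' from funext fun j => if hj : j = i then hj ▸ hi.trans hi'.symm else hS j hj]
    exact Indist.refl hε δ _
  · exact key i S S' hS hi hi'
  · exact (key i S' S (fun j hj => (hS j hj).symm) hi' hi).symm
  · rw [show S = S' from funext fun j => if hj : j = i then hj ▸ hi.trans hi'.symm else hS j hj]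
    exact Indist.refl hε δ _

/-- Bernoulli distributions are indistinguishable if both probabilities have close ratios. -/
lemma indist_bern {p q ε : ℝ} (hp₀ : 0 ≤ p) (hp₁ : p ≤ 1) (hq₀ : 0 ≤ q) (hq₁ : q ≤ 1)
    (h : ∀ b, bernMass p b ≤ Real.exp ε * bernMass q b ∧
      bernMass q b ≤ Real.exp ε * bernMass p b) :
    Indist ε 0 (bern p) (bern q) := by
  have key : ∀ {p q : ℝ}, 0 ≤ p → p ≤ 1 → 0 ≤ q → q ≤ 1 →
      (∀ b, bernMass p b ≤ Real.exp ε * bernMass q b) → ∀ S : Set Bool,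
      (bern p).toOuterMeasure S ≤
        ENNReal.ofReal (Real.exp ε) * (bern q).toOuterMeasure S + ENNReal.ofReal 0 := by
    intro p q hp₀ hp₁ hq₀ hq₁ h S
    rw [PMF.toOuterMeasure_apply, PMF.toOuterMeasure_apply, ENNReal.ofReal_zero, add_zero,
      ← ENNReal.tsum_mul_left]
    refine ENNReal.tsum_le_tsum fun b => ?_
    by_cases hb : b ∈ S
    · rw [Set.indicator_of_mem hb, Set.indicator_of_mem hb, bern_apply hp₀ hp₁,
        bern_apply hq₀ hq₁, ← ENNReal.ofReal_mul (Real.exp_pos ε).le]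
      exact ENNReal.ofReal_le_ofReal (h b)
    · simp [Set.indicator_of_notMem hb]
  exact fun S => ⟨key hp₀ hp₁ hq₀ hq₁ (fun b => (h b).1) S, key hq₀ hq₁ hp₀ hp₁ (fun b => (h b).2) S⟩

lemma IsLadder.indist {π : ℕ → ℝ} {N : ℕ} {ε δ : ℝ} (h : IsLadder π N ε δ) (hε : 0 ≤ ε) (i : ℕ)
    (hi : 1 ≤ i) (hiN : i < N) : Indist ε 0 (bern (π i)) (bern (π (i + 1))) := by
  have hE : 1 ≤ Real.exp ε := Real.one_le_exp hε
  have m : π i ≤ π (i + 1) := h.mono i.le_succ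
  refine indist_bern (h.nonneg _) (h.le_one _) (h.nonneg _) (h.le_one _) ?_
  rintro (_ | _)
  · refine ⟨h.ratio_compl i hi hiN, ?_⟩
    simp only [bernMass]
    nlinarith [h.le_one i]
  · refine ⟨?_, h.ratio i hi hiN⟩
    simp only [bernMass]
    nlinarith [h.nonneg (i + 1)]

/-! ### The probabilities `π` form a ladder -/

section Prob

variable {ε δ : ℝ}

lemma half_lt_halfLength (hε : 0 < ε) (hδ : 0 < δ) :
    1 / 2 < δ * Real.exp (((halfLength ε δ : ℝ) - 1) * ε) := by
  -- Nonemptiness matters: `sInf` of the empty set would be 0.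
  have hne : {j : ℕ | 1 / 2 < δ * Real.exp (((j : ℝ) - 1) * ε)}.Nonempty := by
    obtain ⟨j, hj⟩ := exists_nat_gt (1 / (2 * δ) / ε + 1)
    refine ⟨j, ?_⟩
    have h1 : 1 / (2 * δ) < ((j : ℝ) - 1) * ε := by
      rw [← div_lt_iff₀ hε]; linarith
    have h2 := h1.trans_le ((le_add_of_nonneg_right zero_le_one).trans
      (Real.add_one_le_exp (((j : ℝ) - 1) * ε)))
    rw [div_lt_iff₀ (by positivity)] at h2
    simp only [Set.mem_ofPred_eq]
    linarith
  exact Nat.sInf_mem hne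

lemma le_half_of_lt_halfLength {j : ℕ} (hj : j < halfLength ε δ) :
    δ * Real.exp (((j : ℝ) - 1) * ε) ≤ 1 / 2 :=
  not_lt.1 (Nat.notMem_of_lt_sInf hj)

/-- Keeps the denominator of `rate` positive and makes `halfLength ε δ - 1` a genuine predecessor.
-/
lemma two_le_halfLength (hε : 0 < ε) (hδ : 0 < δ) (hδ' : δ < 1 / 2) : 2 ≤ halfLength ε δ := by
  by_contra h
  have h1 := half_lt_halfLength hε hδ
  have h2 : (halfLength ε δ : ℝ) ≤ 1 := by exact_mod_cast (by omega : halfLength ε δ ≤ 1)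
  have h3 : Real.exp (((halfLength ε δ : ℝ) - 1) * ε) ≤ 1 :=
    Real.exp_le_one_iff.2 (mul_nonpos_of_nonpos_of_nonneg (by linarith) hε.le)
  nlinarith

lemma halfLength_le (hε : 0 < ε) (hδ : 0 < δ) (hδ' : δ < 1 / 2) :
    (halfLength ε δ : ℝ) ≤ 2 + Real.log (1 / (2 * δ)) / ε := by
  have h2 := two_le_halfLength hε hδ hδ'
  have h := le_half_of_lt_halfLength (ε := ε) (δ := δ) (j := halfLength ε δ - 1) (by omega)
  rw [Nat.cast_sub (by omega), Nat.cast_one] at h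
  have h3 : Real.exp (((halfLength ε δ : ℝ) - 1 - 1) * ε) ≤ 1 / (2 * δ) := by
    rw [le_div_iff₀ (by positivity)]; linarith
  have h4 := (Real.le_log_iff_exp_le (by positivity)).2 h3
  rw [← le_div_iff₀ hε] at h4
  linarith

lemma mul_exp_rate (hε : 0 < ε) (hδ : 0 < δ) (hδ' : δ < 1 / 2) :
    δ * Real.exp (((halfLength ε δ : ℝ) - 1) * rate ε δ) = 1 / 2 := by
  have h2 : (2 : ℝ) ≤ halfLength ε δ := by exact_mod_cast two_le_halfLength hε hδ hδ'
  rw [rate, mul_div_cancel₀ _ (by linarith), Real.exp_log (by positivity)]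
  field_simp

lemma rate_nonneg (hε : 0 < ε) (hδ : 0 < δ) (hδ' : δ < 1 / 2) : 0 ≤ rate ε δ := by
  have h2 : (2 : ℝ) ≤ halfLength ε δ := by exact_mod_cast two_le_halfLength hε hδ hδ'
  refine div_nonneg (Real.log_nonneg ?_) (by linarith)
  rw [le_div_iff₀ (by positivity)]
  linarith

/-- At the exponent `(L - 1) r` the value is exactly `1/2`, at `(L - 1) ε` it exceeds `1/2`, and `L
> 1`. -/
lemma rate_le (hε : 0 < ε) (hδ : 0 < δ) (hδ' : δ < 1 / 2) : rate ε δ ≤ ε := by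
  have h2 : (2 : ℝ) ≤ halfLength ε δ := by exact_mod_cast two_le_halfLength hε hδ hδ'
  have h := (mul_exp_rate hε hδ hδ').trans_lt (half_lt_halfLength hε hδ)
  have h3 := Real.exp_lt_exp.1 (lt_of_mul_lt_mul_left h hδ.le)
  exact (lt_of_mul_lt_mul_left h3 (by linarith)).le

lemma prob_zero : prob ε δ 0 = 0 := by simp [prob]

lemma prob_of_le {i : ℕ} (hi : 1 ≤ i) (hiL : i ≤ halfLength ε δ) :
    prob ε δ i = δ * Real.exp (((i : ℝ) - 1) * rate ε δ) := by
  rw [prob, if_neg (by omega), if_pos hiL]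

lemma prob_of_gt {i : ℕ} (hi : 2 * halfLength ε δ < i) : prob ε δ i = 1 := by
  rw [prob, if_neg (by omega), if_neg (by omega), if_neg (by omega)]

/-- This symmetry, which includes `i = 0`, reduces the upper half of the ladder to the lower half.
-/
lemma prob_reflect {i : ℕ} (hi : i ≤ halfLength ε δ) :
    prob ε δ (2 * halfLength ε δ + 1 - i) = 1 - prob ε δ i := by
  rcases Nat.eq_zero_or_pos i with rfl | h
  · rw [prob_of_gt (by omega), prob_zero, sub_zero]
  · rw [prob_of_le h hi, prob, if_neg (by omega), if_neg (by omega), if_pos (by omega),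
      Nat.cast_sub (by omega)]
    push_cast
    ring_nf

lemma prob_halfLength (hε : 0 < ε) (hδ : 0 < δ) (hδ' : δ < 1 / 2) :
    prob ε δ (halfLength ε δ) = 1 / 2 := by
  have := two_le_halfLength hε hδ hδ'
  rw [prob_of_le (by omega) le_rfl, mul_exp_rate hε hδ hδ']

lemma prob_succ_of_lt {i : ℕ} (hi : 1 ≤ i) (hiL : i < halfLength ε δ) :
    prob ε δ (i + 1) = Real.exp (rate ε δ) * prob ε δ i := by
  rw [prob_of_le hi hiL.le, prob_of_le (by omega) (by omega), mul_left_comm, ← Real.exp_add]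
  push_cast
  ring_nf

lemma prob_pos_of_le (hδ : 0 < δ) {i : ℕ} (hi : 1 ≤ i) (hiL : i ≤ halfLength ε δ) :
    0 < prob ε δ i := by
  rw [prob_of_le hi hiL]
  positivity

lemma prob_le_half (hε : 0 < ε) (hδ : 0 < δ) (hδ' : δ < 1 / 2) {i : ℕ} (hi : 1 ≤ i)
    (hiL : i ≤ halfLength ε δ) : prob ε δ i ≤ 1 / 2 := by
  rw [prob_of_le hi hiL, ← mul_exp_rate hε hδ hδ']
  have h : (i : ℝ) ≤ halfLength ε δ := by exact_mod_cast hiL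
  have := rate_nonneg hε hδ hδ'
  gcongr

lemma prob_step_bounds (hε : 0 < ε) (hδ : 0 < δ) (hδ' : δ < 1 / 2) {i : ℕ} (hi : 1 ≤ i)
    (hiN : i < 2 * halfLength ε δ) :
    prob ε δ i ≤ prob ε δ (i + 1) ∧ prob ε δ (i + 1) ≤ Real.exp ε * prob ε δ i ∧
      1 - prob ε δ i ≤ Real.exp ε * (1 - prob ε δ (i + 1)) := by
  -- For `y = E x ≤ 1/2` the complements satisfy `E (1 - y) - (1 - x) = (E - 1) (1 - x - y) ≥ 0`.
  have low : ∀ {x y E F : ℝ}, 1 ≤ E → E ≤ F → 0 < x → y = E * x → y ≤ 1 / 2 →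
      x ≤ y ∧ y ≤ F * x ∧ 1 - x ≤ F * (1 - y) := by
    rintro x y E F hE hF hx rfl hy
    have h1 : x ≤ E * x := le_mul_of_one_le_left hx.le hE
    have h2 : 0 ≤ (E - 1) * (1 - x - E * x) := mul_nonneg (by linarith) (by linarith)
    have h3 : E * (1 - E * x) ≤ F * (1 - E * x) := mul_le_mul_of_nonneg_right hF (by linarith)
    refine ⟨h1, mul_le_mul_of_nonneg_right hF hx.le, ?_⟩
    linarith
  have hE : 1 ≤ Real.exp (rate ε δ) := Real.one_le_exp (rate_nonneg hε hδ hδ')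
  have hF : Real.exp (rate ε δ) ≤ Real.exp ε := Real.exp_le_exp.2 (rate_le hε hδ hδ')
  rcases lt_trichotomy i (halfLength ε δ) with h | h | h
  · exact low hE hF (prob_pos_of_le hδ hi h.le) (prob_succ_of_lt hi h)
      (prob_le_half hε hδ hδ' (by omega) h)
  -- The middle step is flat: reflection sends `L` to `L + 1`, and both values are `1/2`.
  · have h1 := prob_reflect (le_refl (halfLength ε δ))
    rw [show 2 * halfLength ε δ + 1 - halfLength ε δ = i + 1 by omega] at h1
    rw [h1, h, prob_halfLength hε hδ hδ']
    have := hE.trans hF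
    refine ⟨?_, ?_, ?_⟩ <;> linarith
  -- Reflection swaps the ratio bound and the complementary one.
  · obtain ⟨j, rfl⟩ : ∃ j, i = 2 * halfLength ε δ - j := ⟨2 * halfLength ε δ - i, by omega⟩
    have e1 := prob_reflect (ε := ε) (δ := δ) (i := j + 1) (by omega)
    have e2 := prob_reflect (ε := ε) (δ := δ) (i := j) (by omega)
    rw [show 2 * halfLength ε δ + 1 - (j + 1) = 2 * halfLength ε δ - j by omega] at e1
    rw [show 2 * halfLength ε δ + 1 - j = 2 * halfLength ε δ - j + 1 by omega] at e2
    obtain ⟨h1, h2, h3⟩ := low hE hF (prob_pos_of_le (ε := ε) hδ (i := j) (by omega) (by omega))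
      (prob_succ_of_lt (by omega) (by omega)) (prob_le_half hε hδ hδ' (by omega) (by omega))
    rw [e1, e2]
    refine ⟨?_, ?_, ?_⟩ <;> linarith

lemma isLadder_prob (hε : 0 < ε) (hδ : 0 < δ) (hδ' : δ < 1 / 2) :
    IsLadder (prob ε δ) (2 * halfLength ε δ) ε δ := by
  have hL := two_le_halfLength hε hδ hδ'
  have first : prob ε δ 1 = δ := by rw [prob_of_le le_rfl (by omega)]; simp
  have last : prob ε δ (2 * halfLength ε δ) = 1 - δ := by
    have := prob_reflect (ε := ε) (δ := δ) (i := 1) (by omega)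
    rwa [Nat.add_sub_cancel, first] at this
  refine ⟨monotone_nat_of_le_succ fun i => ?_, prob_zero, first, last, fun i => prob_of_gt,
    fun i hi hiN => (prob_step_bounds hε hδ hδ' hi hiN).2.1,
    fun i hi hiN => (prob_step_bounds hε hδ hδ' hi hiN).2.2⟩
  rcases Nat.eq_zero_or_pos i with rfl | hi
  · rw [prob_zero, first]; exact hδ.le
  rcases lt_trichotomy i (2 * halfLength ε δ) with h | rfl | h
  · exact (prob_step_bounds hε hδ hδ' hi h).1
  · rw [last, prob_of_gt (Nat.lt_succ_self _)]; linarith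
  · rw [prob_of_gt h, prob_of_gt (h.trans i.lt_succ_self)]

lemma interpolates_prob (hε : 0 < ε) (hδ : 0 < δ) (hδ' : δ < 1 / 2) :
    Interpolates (prob ε δ) (halfLength ε δ) ε δ := by
  have h := isLadder_prob hε hδ hδ'
  exact ⟨fun i => ⟨h.nonneg i, h.le_one i⟩, h.zero, h.first, h.last, h.top, h.indist hε.le⟩

end Prob

/-! ### Choice of the constants -/

lemma two_lt_log_one_div {δ : ℝ} (hδ : 0 < δ) (hδ' : δ < 1 / 10) : 2 < Real.log (1 / δ) := by
  rw [Real.lt_log_iff_exp_lt (by positivity), lt_div_iff₀ hδ]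
  have h1 : Real.exp 2 = Real.exp 1 * Real.exp 1 := by rw [← Real.exp_add]; norm_num
  have h2 := Real.exp_one_lt_d9
  have h3 : Real.exp 2 < 10 := by rw [h1]; nlinarith [Real.exp_pos 1]
  nlinarith

/-- The moment of order about `3 log (1/δ) / ε` yields the error `δ / 2`. -/
lemma exists_moment {ε δ ε' : ℝ} (hε : 0 < ε) (hε2 : ε ≤ 2) (hδ : 0 < δ) (hδ' : δ < 1 / 10)
    (hε' : ε' = 1 / 100 * ε ^ 2 / Real.log (1 / δ)) :
    ∃ n : ℕ, (n + 1) * (Real.exp ε' - 1) ≤ 1 ∧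
      Real.exp ((n + 1) ^ 2 * (2 * (Real.exp ε' - 1)) - n * ε) ≤ δ / 2 := by
  have hl := two_lt_log_one_div hδ hδ'
  set l := Real.log (1 / δ) with hl_def
  have hl0 : 0 < l := by linarith
  have hε'0 : 0 ≤ ε' := by rw [hε']; positivity
  have hε'l : ε' * l = ε ^ 2 / 100 := by rw [hε']; field_simp
  have hε'1 : ε' ≤ 1 := by nlinarith
  have hx : Real.exp ε' - 1 ≤ 2 * ε' := by
    have := Real.abs_exp_sub_one_le (x := ε') (by rwa [abs_of_nonneg hε'0])
    rw [abs_of_nonneg hε'0] at this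
    exact (le_abs_self _).trans this
  have hx0 : 0 ≤ Real.exp ε' - 1 := by linarith [Real.one_le_exp hε'0]
  obtain ⟨n, hn⟩ : ∃ n : ℕ, n = ⌈3 * l / ε⌉₊ := ⟨_, rfl⟩
  have hn1 : 3 * l ≤ n * ε := by rw [← div_le_iff₀ hε, hn]; exact Nat.le_ceil _
  -- Rounding costs `2 * ε ≤ 4`, which is below `2 * l`.
  have hn2 : (n + 1) * ε ≤ 5 * l := by
    have := Nat.ceil_lt_add_one (a := 3 * l / ε) (by positivity)
    rw [← hn, ← sub_lt_iff_lt_add, lt_div_iff₀ hε] at this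
    linarith
  have hm0 : (0 : ℝ) ≤ n + 1 := by positivity
  have hm1 : (n + 1) * ε' ≤ ε / 20 := by
    have : (n + 1) * ε' * l ≤ ε / 20 * l := by
      calc (n + 1) * ε' * l = (n + 1) * ε * (ε / 100) := by rw [mul_assoc, hε'l]; ring
        _ ≤ 5 * l * (ε / 100) := mul_le_mul_of_nonneg_right hn2 (by positivity)
        _ = _ := by ring
    exact le_of_mul_le_mul_right this hl0
  have hm2 : (n + 1) ^ 2 * ε' ≤ l / 4 := by
    calc ((n : ℝ) + 1) ^ 2 * ε' = (n + 1) * ((n + 1) * ε') := by ring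
      _ ≤ (n + 1) * (ε / 20) := mul_le_mul_of_nonneg_left hm1 hm0
      _ ≤ _ := by linarith
  refine ⟨n, ?_, ?_⟩
  · have := mul_le_mul_of_nonneg_left hx hm0
    linarith
  -- The quadratic term is at most `4 * (l / 4) = l` and `n * ε ≥ 3 * l`, so the error is at most
  -- `δ²`, which is below `δ / 2`.
  · have h1 : ((n : ℝ) + 1) ^ 2 * (2 * (Real.exp ε' - 1)) - n * ε ≤ -l + -l := by
      have := mul_le_mul_of_nonneg_left hx (by positivity : (0 : ℝ) ≤ ((n : ℝ) + 1) ^ 2)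
      linarith
    refine (Real.exp_le_exp.2 h1).trans ?_
    have e : Real.exp (-l) = δ := by
      rw [hl_def, one_div, Real.log_inv, neg_neg, Real.exp_log hδ]
    rw [Real.exp_add, e]
    nlinarith

lemma two_mul_halfLength_le {ε δ ε' δ' : ℝ} (hε : 0 < ε) (hε2 : ε ≤ 2) (hδ : 0 < δ)
    (hδ1 : δ < 1 / 10) (hε' : ε' = 1 / 100 * ε ^ 2 / Real.log (1 / δ)) (hδ' : δ' = 1 / 20 * δ) :
    (2 * halfLength ε' δ' : ℝ) ≤ 1000 * (Real.log (1 / δ) ^ 2 / ε ^ 2) := by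
  have hl := two_lt_log_one_div hδ hδ1
  have hε'0 : 0 < ε' := by rw [hε']; positivity
  have h := halfLength_le (ε := ε') (δ := δ') hε'0 (by linarith) (by linarith)
  have h1 : Real.log (1 / (2 * δ')) ≤ 2 * Real.log (1 / δ) := by
    have : Real.log (1 / δ ^ 2) = 2 * Real.log (1 / δ) := by
      rw [one_div, one_div, Real.log_inv, Real.log_inv, Real.log_pow]; push_cast; ring
    rw [← this]
    have hd : 0 < δ' := by linarith
    -- Here `2 * δ' = δ / 10 ≥ δ²`, because `δ < 1 / 10`.
    refine Real.log_le_log (by positivity) (one_div_le_one_div_of_le (by positivity) ?_)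
    nlinarith
  set l := Real.log (1 / δ) with hl_def
  have h2 : Real.log (1 / (2 * δ')) / ε' ≤ 200 * (l ^ 2 / ε ^ 2) := by
    rw [div_le_iff₀ hε'0, hε']
    have : 200 * (l ^ 2 / ε ^ 2) * (1 / 100 * ε ^ 2 / l) = 2 * l := by
      field_simp; norm_num
    rwa [this]
  -- Lets the additive constant from rounding be absorbed into the main term; it uses `ε ≤ 2 < l`.
  have h3 : 1 ≤ l ^ 2 / ε ^ 2 := by
    rw [le_div_iff₀ (by positivity), one_mul]
    exact pow_le_pow_left₀ hε.le (by linarith) 2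
  linarith

end

end JDPMirror

theorem mainTheorem7 :
    -- the absolute constants in `ε' = O(ε² / log (1/δ))`, `δ' = O(δ)` and in the mistake bound
    ∃ c₁ c₂ B : ℝ, 0 < c₁ ∧ 0 < c₂ ∧ c₂ ≤ 1 ∧ 0 < B ∧
      ∀ ε δ : ℝ, 0 < ε → ε ≤ 2 → 0 < δ → δ < 1 / 10 →
      ∀ ε' δ' : ℝ, ε' = c₁ * ε ^ 2 / Real.log (1 / δ) → δ' = c₂ * δ →
        JDPMirror.Interpolates (JDPMirror.prob ε' δ') (JDPMirror.halfLength ε' δ') ε' δ' ∧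
        (2 * JDPMirror.halfLength ε' δ' : ℝ) ≤ B * (Real.log (1 / δ) ^ 2 / ε ^ 2) ∧
        ∀ K : ℕ, 1 ≤ K → ∀ T : ℕ,
          JDPMirror.IsJDP (JDPMirror.algorithm ε' δ' K T) ε δ ∧
          ∀ Δ : Fin T → Bool, ∀ y ∈ (JDPMirror.algorithm ε' δ' K T Δ).support,
            JDPMirror.IsValidMirror K Δ y ∧
            JDPMirror.mistakes K Δ y ≤ 2 * JDPMirror.halfLength ε' δ' := by
  refine ⟨1 / 100, 1 / 20, 1000, by norm_num, by norm_num, by norm_num, by norm_num, ?_⟩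
  intro ε δ hε hε2 hδ hδ1 ε' δ' hε' hδ'
  have hl := JDPMirror.two_lt_log_one_div hδ hδ1
  have hε'0 : 0 < ε' := by rw [hε']; positivity
  have hδ'0 : 0 < δ' := by linarith
  have hδ'1 : δ' < 1 / 2 := by linarith
  have h := JDPMirror.isLadder_prob hε'0 hδ'0 hδ'1
  obtain ⟨n, hn1, hn2⟩ := JDPMirror.exists_moment hε hε2 hδ hδ1 hε'
  refine ⟨JDPMirror.interpolates_prob hε'0 hδ'0 hδ'1,
    JDPMirror.two_mul_halfLength_le hε hε2 hδ hδ1 hε' hδ', fun K _ T => ⟨?_, fun Δ y hy => ⟨?_, ?_⟩⟩⟩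
  -- The error budget is `δ / 2` from the moment bound plus `2 * δ' = δ / 10` from the two jumps.
  · exact JDPMirror.isJDP_run h hδ'0 hε'0.le hε.le n hn1 (by linarith) K T
  · exact JDPMirror.isValidMirror_of_mem_support h.nonneg h.le_one h.zero hy
  · exact JDPMirror.mistakes_le_of_mem_support h.nonneg h.le_one h.top hy
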